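/- Conventions. Two classes $\mathcal C,\mathcal D$ of topological spaces (not necessarily closed under homeomorphic copies) are equivalent if every space in $\mathcal C$ is homeomorphic to a space in $\mathcal D$ and vice versa. A continuum is a connected compactum; the empty space is allowed both as a compactum and as a continuum. A composition of a class $\mathcal C$ is a continuous map $q\colon A\to B$ of topological spaces such that the class of fibers $\{q^{-1}(b): b\in B\}$ is equivalent to $\mathcal C$. The composition is strong if $q$ is a closed and open map and $|B\setminus q(A)|\le 1$. A class is compactifiable if it has a composition $q\colon A\to B$ with $A$ and $B$ metrizable compacta, and strongly Polishable if it has a strong composition $q\colon A\to B$ with $A$ and $B$ Polish spaces. A class $\mathcal C$ of metrizable compacta is closed under continuous images if every metrizable compactum that is a continuous image of a member of $\mathcal C$ belongs to $\mathcal C$. A common model of $\mathcal C$ is a member of $\mathcal C$ that maps continuously onto every member of $\mathcal C$. Theorem. 1. If $\mathcal C$ is a strongly Polishable class of compacta, then the class of all metrizable compacta that are continuous images of members of $\mathcal C$ is strongly Polishable, and the class of all metrizable continua that are continuous images of members of $\mathcal C$ is compactifiable. 2. Every class of metrizable compacta that is closed under continuous images and has a common model is strongly Polishable. 3. Every class of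 metrizable continua that is closed under continuous images and has a common model is compactifiable. 4. The class of all Peano continua (nonempty locally connected metrizable continua) is closed under continuous images, has $[0,1]$ as a common model (so the Peano continua are exactly the metrizable compacta that are continuous images of $[0,1]$), and is compactifiable. 5. Let $P$ be a pseudo-arc, i.e. a nondegenerate metrizable continuum that is chainable (every open cover is refined by a finite open cover $U_1,\dots,U_n$ such that $U_i\cap U_j\ne\emptyset$ if and only if $|i-j|\le 1$) and hereditarily indecomposable (no subcontinuum of $P$ is the union of two of its proper nonempty subcontinua). The class of all weakly chainable continua, i.e. of all metrizable compacta that are continuous images of $P$, consists of continua, is closed under continuous images, has $P$ as a common model, and is compactifiable. -/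

import Mathlib

universe u

/-! A class of topological spaces is a set `C : Set TopCat.{u}`; it need not be closed under
homeomorphic copies. -/

namespace CompactaClasses

/-- Every space in `C` is homeomorphic to a space in `D` and vice versa. -/
def Equivalent (C D : Set TopCat.{u}) : Prop :=
  (∀ X ∈ C, ∃ Y ∈ D, Nonempty (X ≃ₜ Y)) ∧ (∀ Y ∈ D, ∃ X ∈ C, Nonempty (Y ≃ₜ X))

/-- The class of all metrizable compacta (the empty space included). -/
def metrizableCompacta : Set TopCat.{u} :=
  {X | CompactSpace X ∧ TopologicalSpace.MetrizableSpace X}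

/-- The class of all metrizable continua, that is, connected metrizable compacta. The empty space
is included. -/
def metrizableContinua : Set TopCat.{u} :=
  {X | X ∈ metrizableCompacta ∧ PreconnectedSpace X}

/-- There is a continuous map from `X` onto `Y`. -/
def MapsOnto (X Y : TopCat.{u}) : Prop :=
  ∃ f : X → Y, Continuous f ∧ Function.Surjective f

/-- The class of all continuous images of members of `C`. -/
def continuousImages (C : Set TopCat.{u}) : Set TopCat.{u} :=
  {Y | ∃ X ∈ C, MapsOnto X Y}

/-- A class of metrizable compacta is closed under continuous images if every metrizable compactum
that is a continuous image of a member belongs to the class. -/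
def ClosedUnderContinuousImages (C : Set TopCat.{u}) : Prop :=
  continuousImages C ∩ metrizableCompacta ⊆ C

/-- `M` is a common model of `C`: a member of `C` that maps continuously onto every member. -/
def IsCommonModel (M : TopCat.{u}) (C : Set TopCat.{u}) : Prop :=
  M ∈ C ∧ ∀ X ∈ C, MapsOnto M X

/-- The class of all fibers `q ⁻¹' {b}`, `b ∈ B`, with their subspace topologies. -/
def fibers {A B : Type u} [TopologicalSpace A] (q : A → B) : Set TopCat.{u} :=
  {X | ∃ b : B, X = TopCat.of (q ⁻¹' {b})}

/-- The map `q : A → B` is a composition of the class `C`. -/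
def IsComposition {A B : Type u} [TopologicalSpace A] [TopologicalSpace B] (q : A → B)
    (C : Set TopCat.{u}) : Prop :=
  Continuous q ∧ Equivalent (fibers q) C

/-- A composition map is strong if it is closed and open and misses at most one point. -/
def IsStrong {A B : Type u} [TopologicalSpace A] [TopologicalSpace B] (q : A → B) : Prop :=
  IsClosedMap q ∧ IsOpenMap q ∧ ((Set.range q)ᶜ).Subsingleton

/-- `C` has a composition between metrizable compacta. -/
def IsCompactifiable (C : Set TopCat.{u}) : Prop :=
  ∃ (A B : TopCat.{u}) (q : A → B),
    A ∈ metrizableCompacta ∧ B ∈ metrizableCompacta ∧ IsComposition q C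

/-- `C` has a strong composition between Polish spaces. -/
def IsStronglyPolishable (C : Set TopCat.{u}) : Prop :=
  ∃ (A B : TopCat.{u}) (q : A → B),
    PolishSpace A ∧ PolishSpace B ∧ IsStrong q ∧ IsComposition q C

/-- The class of all Peano continua: nonempty locally connected metrizable continua. -/
def peanoContinua : Set TopCat.{u} :=
  {X | X ∈ metrizableContinua ∧ Nonempty X ∧ LocallyConnectedSpace X}

/-- A finite sequence of sets is a chain if exactly the neighboring members (and each member with
itself) intersect. -/
def IsChainOfSets {X : Type u} {n : ℕ} (U : Fin n → Set X) : Prop :=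
  ∀ i j : Fin n, (U i ∩ U j).Nonempty ↔ (i : ℕ) ≤ j + 1 ∧ (j : ℕ) ≤ i + 1

/-- Every open cover is refined by a finite open cover that is a chain. -/
def IsChainable (X : Type u) [TopologicalSpace X] : Prop :=
  ∀ W : Set (Set X), (∀ V ∈ W, IsOpen V) → ⋃₀ W = Set.univ →
    ∃ (n : ℕ) (U : Fin n → Set X),
      (∀ i, IsOpen (U i)) ∧ (⋃ i, U i) = Set.univ ∧ (∀ i, ∃ V ∈ W, U i ⊆ V) ∧ IsChainOfSets U

/-- No subcontinuum of `X` is the union of two proper subcontinua. -/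
def IsHereditarilyIndecomposable (X : Type u) [TopologicalSpace X] : Prop :=
  ∀ K A B : Set X, IsClosed K → IsConnected K → IsClosed A → IsConnected A →
    IsClosed B → IsConnected B → A ∪ B = K → A = K ∨ B = K

/-- A pseudo-arc: a nondegenerate hereditarily indecomposable chainable metrizable continuum. -/
def IsPseudoArc (P : TopCat.{u}) : Prop :=
  P ∈ metrizableContinua ∧ Nontrivial P ∧ IsChainable P ∧ IsHereditarilyIndecomposable P

/-- For a pseudo-arc `P` (it is unique up to homeomorphism), the class of all weakly chainable
continua: the metrizable compacta that are continuous images of `P`. -/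
def weaklyChainableContinua (P : TopCat.{u}) : Set TopCat.{u} :=
  continuousImages {P} ∩ metrizableCompacta

end CompactaClasses

/-! A closed and open map has fibers that vary continuously in the hyperspace of compacta. Embed `A`
in the Hilbert cube `Q`. By Tietze, every continuous map from a fiber to `Q` extends to a member of
`C(Q, Q)`, so the nonempty images of fibers are listed continuously by the Polish space `range q ×
C(Q, Q)` (`IsStronglyPolishable.exists_continuous_ranges`). The membership relation over this space,
projected to the parameter, is a strong composition.

For continua, restrict to the closed set of connected values and reparametrize by the Baire space.
Put the latter in the compactum `(ℕ ∪ {∞})^ℕ` and take the closure of the graph of the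
parametrization. Over a new point `(x, K)` whose first infinite coordinate is `n`, the fiber is a
finite union of boxes of mesh `2⁻ⁿ` around `K`, which is a Peano continuum. It belongs to the class
as soon as some member is nondegenerate: such a member maps onto `[0,1]`, and `[0,1]` maps onto
every Peano continuum by Hahn–Mazurkiewicz.

A class with a common model `M` consists of the images of `M`, so everything else follows from the
case of `{M}`. -/

namespace CompactaClasses

open Set Metric TopologicalSpace Topology

/-! ### The Hahn–Mazurkiewicz theorem. -/

theorem exists_ball_subset_connectedComponentIn {X : Type*} [PseudoMetricSpace X] [CompactSpace X]
    [LocallyConnectedSpace X] {ε : ℝ} (hε : 0 < ε) :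
    ∃ δ > 0, ∀ x : X, ball x δ ⊆ connectedComponentIn (ball x ε) x := by
  -- The Lebesgue number lemma gives a component around some other center `y`; radius `ε / 2` keeps
  -- it inside `ball x ε`.
  obtain ⟨δ, hδ, h⟩ := lebesgue_number_lemma_of_metric (s := univ)
    (c := fun x : X => connectedComponentIn (ball x (ε / 2)) x) isCompact_univ
    (fun x => isOpen_ball.connectedComponentIn)
    (fun x _ => mem_iUnion.2 ⟨x, mem_connectedComponentIn (mem_ball_self (by positivity))⟩)
  refine ⟨δ, hδ, fun x => ?_⟩
  obtain ⟨y, hy⟩ := h x (mem_univ x)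
  refine hy.trans ?_
  have hx := hy (mem_ball_self hδ)
  refine isPreconnected_connectedComponentIn.subset_connectedComponentIn hx fun z hz => ?_
  have h1 := connectedComponentIn_subset _ _ hx
  have h2 := connectedComponentIn_subset _ _ hz
  rw [mem_ball] at *
  linarith [dist_triangle_right z x y]

/-- `w` is a walk in `E` from `a` to `b` with steps shorter than `δ`, which has arrived after `n`
steps and then stays. -/
structure IsWalk {X : Type*} [PseudoMetricSpace X] (E : Set X) (δ : ℝ) (a b : X) (n : ℕ)
    (w : ℕ → X) : Prop where
  start : w 0 = a
  finish : ∀ i ≥ n, w i = b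
  mem : ∀ i, w i ∈ E
  step : ∀ i, dist (w i) (w (i + 1)) < δ

section Walk

variable {X : Type*} [PseudoMetricSpace X] {E : Set X} {δ : ℝ} {a b c : X}

theorem isWalk_const (ha : a ∈ E) (hδ : 0 < δ) (n : ℕ) : IsWalk E δ a a n fun _ => a :=
  ⟨rfl, fun _ _ => rfl, fun _ => ha, fun _ => by simpa⟩

theorem IsWalk.mono {n m : ℕ} {w : ℕ → X} (h : IsWalk E δ a b n w) (hnm : n ≤ m) :
    IsWalk E δ a b m w :=
  ⟨h.start, fun i hi => h.finish i (hnm.trans hi), h.mem, h.step⟩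

theorem IsWalk.trans {n m : ℕ} {w v : ℕ → X} (hw : IsWalk E δ a b n w) (hv : IsWalk E δ b c m v) :
    IsWalk E δ a c (n + m) fun i => if i ≤ n then w i else v (i - n) where
  start := by simp [hw.start]
  finish i hi := by
    by_cases h : i ≤ n
    · have hm : m = 0 := by omega
      have hi' : i = n := by omega
      subst hm hi'
      simp only [le_refl, if_true]
      rw [hw.finish i le_rfl, ← hv.start, hv.finish 0 le_rfl]
    · simp only [h, if_false]
      exact hv.finish _ (by omega)
  mem i := by
    split_ifs
    exacts [hw.mem i, hv.mem _]
  step i := by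
    by_cases h : i + 1 ≤ n
    · simpa [h, (Nat.le_succ i).trans h] using hw.step i
    · by_cases h' : i ≤ n
      · have hi' : i = n := by omega
        subst hi'
        simp only [le_refl, if_true, h, if_false]
        rw [hw.finish i le_rfl, ← hv.start]
        simpa using hv.step 0
      · simp only [h, h', if_false]
        have : i + 1 - n = i - n + 1 := by omega
        rw [this]
        exact hv.step _

theorem exists_isWalk (hE : IsPreconnected E) (hδ : 0 < δ) (ha : a ∈ E) (hb : b ∈ E) :
    ∃ n w, IsWalk E δ a b n w := by
  refine hE.induction₂' (fun x y => x ∈ E → y ∈ E → ∃ n w, IsWalk E δ x y n w) ?_ ?_ ha hb ha hb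
  · have key : ∀ x ∈ E, ∀ y ∈ E, dist x y < δ → ∃ n w, IsWalk E δ x y n w := by
      intro x hx y hy hxy
      refine ⟨1, fun i => if i = 0 then x else y, by simp, fun i hi => ?_, fun i => ?_, fun i => ?_⟩
      · simp [Nat.one_le_iff_ne_zero.1 hi]
      · split_ifs <;> assumption
      · by_cases hi : i = 0 <;> simp [hi, hxy, hδ]
    intro x hx
    filter_upwards [self_mem_nhdsWithin, mem_nhdsWithin_of_mem_nhds (ball_mem_nhds x hδ)] with y hy hd
    exact ⟨fun _ _ => key x hx y hy (by rwa [dist_comm]), fun _ _ => key y hy x hx hd⟩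
  · intro x y z hx hy hz h1 h2 _ _
    obtain ⟨n, w, hw⟩ := h1 hx hy
    obtain ⟨m, v, hv⟩ := h2 hy hz
    exact ⟨_, _, hw.trans hv⟩

theorem exists_isWalk_visiting (hE : IsPreconnected E) (hδ : 0 < δ) (ha : a ∈ E) (hb : b ∈ E)
    {S : Set X} (hS : S.Finite) (hSE : S ⊆ E) :
    ∃ n w, IsWalk E δ a b n w ∧ ∀ s ∈ S, ∃ i < n, w i = s := by
  induction S, hS using Set.Finite.induction_on generalizing a with
  | empty =>
    obtain ⟨n, w, h⟩ := exists_isWalk hE hδ ha hb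
    exact ⟨n, w, h, by simp⟩
  | @insert s S _ _ ih =>
    have hs := hSE (mem_insert _ _)
    obtain ⟨m, v, hv⟩ := exists_isWalk hE hδ ha hs
    obtain ⟨n, w, hw, h⟩ := ih hs ((subset_insert _ _).trans hSE)
    -- One idle step is added so that the visit to `s` at time `m` is strictly before the end even
    -- if `n = 0`.
    refine ⟨_, _, (hv.trans hw).mono (Nat.le_succ _), ?_⟩
    rintro t (rfl | ht)
    · exact ⟨m, by omega, by simp [hv.finish m le_rfl]⟩
    · obtain ⟨i, hi, hit⟩ := h t ht
      refine ⟨m + i, by omega, ?_⟩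
      by_cases h0 : i = 0
      · subst h0
        rw [← hit, hw.start]
        simp [hv.finish m le_rfl]
      · have : ¬ (m + i ≤ m) := by omega
        simp [hit, h0]

theorem exists_dense_isWalk (hE : IsPreconnected E) (hE' : TotallyBounded E) (hδ : 0 < δ)
    (ha : a ∈ E) (hb : b ∈ E) :
    ∃ n w, IsWalk E δ a b n w ∧ ∀ x ∈ E, ∃ i < n, dist x (w i) < δ := by
  obtain ⟨S, hSE, hS, hcov⟩ := hE'.exists_subset (dist_mem_uniformity hδ)
  obtain ⟨n, w, hw, h⟩ := exists_isWalk_visiting hE hδ ha hb hS hSE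
  refine ⟨n, w, hw, fun x hx => ?_⟩
  obtain ⟨s, hs, hxs⟩ := mem_iUnion₂.1 (hcov hx)
  obtain ⟨i, hi, rfl⟩ := h s hs
  exact ⟨i, hi, hxs⟩

end Walk

/-- A finite `δ`-dense sequence `z 0, …, z M` with steps shorter than `δ`, continued constantly. -/
structure IsFineSequence {X : Type*} [PseudoMetricSpace X] (δ : ℝ) (p : ℕ × (ℕ → X)) : Prop where
  pos : 0 < p.1
  const : ∀ i ≥ p.1, p.2 i = p.2 p.1
  step : ∀ i, dist (p.2 i) (p.2 (i + 1)) < δ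
  dense : ∀ x, ∃ i < p.1, dist x (p.2 i) < δ

theorem exists_isFineSequence {X : Type*} [PseudoMetricSpace X] [CompactSpace X] [ConnectedSpace X]
    {δ : ℝ} (hδ : 0 < δ) : ∃ p : ℕ × (ℕ → X), IsFineSequence δ p := by
  obtain ⟨x⟩ := (inferInstance : Nonempty X)
  obtain ⟨n, w, hw, h⟩ := exists_dense_isWalk (E := univ) (isPreconnected_univ)
    isCompact_univ.totallyBounded hδ (mem_univ x) (mem_univ x)
  obtain ⟨i, hi, -⟩ := h x (mem_univ x)
  exact ⟨(n, w), by dsimp only; omega, fun i hi =>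
    (hw.finish i hi).trans (hw.finish n le_rfl).symm, hw.step, fun x => h x (mem_univ x)⟩

/-- `p'` divides every step of `p` into `N` steps, all within `ε` of its start. -/
def IsRefinement {X : Type*} [PseudoMetricSpace X] (ε : ℝ) (p p' : ℕ × (ℕ → X)) : Prop :=
  ∃ N > 0, p'.1 = p.1 * N ∧ ∀ k, dist (p.2 (k / N)) (p'.2 k) < ε

/-- A step of `p` has both ends in the connected set `E i`, so it can be replaced by a walk that is
`δ'`-dense in `E i`. The sets `E i`, `i < M`, contain the `δ`-balls around the points of `p`, hence
cover `X`. All walks are padded to a common length `N`, so that `k / N` recovers the original step.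
-/
theorem IsFineSequence.exists_refinement {X : Type*} [PseudoMetricSpace X] [CompactSpace X]
    {ε δ δ' : ℝ} (hδ : ∀ x : X, ball x δ ⊆ connectedComponentIn (ball x ε) x) (hδ' : 0 < δ')
    {p : ℕ × (ℕ → X)} (hp : IsFineSequence δ p) :
    ∃ p' : ℕ × (ℕ → X), IsFineSequence δ' p' ∧ IsRefinement ε p p' := by
  obtain ⟨M, z⟩ := p
  obtain ⟨hM, hconst, hstep, hdense⟩ := hp
  dsimp only at *
  have hδ0 : 0 < δ := dist_nonneg.trans_lt (hstep 0)
  set E : ℕ → Set X := fun i => connectedComponentIn (ball (z i) ε) (z i) with hEdef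
  have hself : ∀ i, z i ∈ E i := fun i => hδ _ (mem_ball_self hδ0)
  have hnext : ∀ i, z (i + 1) ∈ E i := fun i => hδ _ (by rw [mem_ball']; exact hstep i)
  have hwalk : ∀ i, ∃ n w, IsWalk (E i) δ' (z i) (z (i + 1)) n w ∧
      (i < M → ∀ x ∈ E i, ∃ j < n, dist x (w j) < δ') ∧ (M ≤ i → n = 0 ∧ ∀ j, w j = z M) := by
    intro i
    by_cases hi : i < M
    · obtain ⟨n, w, hw, h⟩ := exists_dense_isWalk (E := E i) isPreconnected_connectedComponentIn
        (isCompact_univ.totallyBounded.subset (subset_univ _)) hδ' (hself i) (hnext i)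
      exact ⟨n, w, hw, fun _ => h, fun h' => by omega⟩
    · refine ⟨0, fun _ => z i, ?_, fun h' => absurd h' hi, fun _ => ⟨rfl, fun _ => hconst i (by omega)⟩⟩
      rw [hconst (i + 1) (by omega), ← hconst i (by omega)]
      exact isWalk_const (hself i) hδ' 0
  choose n w hw hwd hwc using hwalk
  set N := ∑ i ∈ Finset.range M, n i + 1 with hN
  have hnN : ∀ i, n i ≤ N := by
    intro i
    by_cases hi : i < M
    · exact (Finset.single_le_sum (f := n) (fun _ _ => Nat.zero_le _)
        (Finset.mem_range.2 hi)).trans (Nat.le_succ _)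
    · rw [(hwc i (by omega)).1]
      exact Nat.zero_le _
  have hN0 : 0 < N := Nat.succ_pos _
  have hbig : ∀ k ≥ M * N, w (k / N) (k % N) = z M := fun k hk =>
    (hwc _ ((Nat.le_div_iff_mul_le hN0).2 hk)).2 _
  refine ⟨(M * N, fun k => w (k / N) (k % N)), ⟨Nat.mul_pos hM hN0, fun i hi => ?_, fun k => ?_,
    fun x => ?_⟩, N, hN0, rfl, fun k => ?_⟩
  · dsimp only at *
    rw [hbig i hi, hbig _ le_rfl]
  · dsimp only
    have hlt := Nat.mod_lt k hN0
    have hk := Nat.div_add_mod k N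
    by_cases hkN : k % N + 1 < N
    · have h1 : (k + 1) / N = k / N := by
        rw [Nat.div_eq_iff hN0, mul_comm (k / N) N]
        constructor <;> omega
      have h2 : (k + 1) % N = k % N + 1 := by
        have := Nat.div_add_mod (k + 1) N
        rw [h1] at this
        omega
      rw [h1, h2]
      exact (hw _).step _
    · have hk1 : k + 1 = N * (k / N + 1) := by
        rw [mul_add, mul_one]
        omega
      have h1 : (k + 1) / N = k / N + 1 := by rw [hk1, Nat.mul_div_cancel_left _ hN0]
      have h2 : (k + 1) % N = 0 := by rw [hk1, Nat.mul_mod_right]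
      -- At the end of a block the walk has already arrived at the start of the next one.
      rw [h1, h2, (hw _).start, ← (hw (k / N)).finish (k % N + 1) ((hnN _).trans (by omega))]
      exact (hw _).step _
  · obtain ⟨i, hi, hx⟩ := hdense x
    obtain ⟨j, hj, hxj⟩ := hwd i hi x (hδ _ hx)
    have hjN : j < N := hj.trans_le (hnN i)
    refine ⟨N * i + j, by dsimp only; nlinarith, ?_⟩
    dsimp only
    rwa [Nat.mul_add_div hN0, Nat.div_eq_of_lt hjN, add_zero, Nat.mul_add_mod, Nat.mod_eq_of_lt hjN]
  · have := connectedComponentIn_subset _ _ ((hw (k / N)).mem (k % N))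
    rwa [mem_ball'] at this

theorem exists_dependent_sequence {α : Type*} {P : ℕ → α → Prop} {R : ℕ → α → α → Prop}
    (h0 : ∃ a, P 0 a) (h : ∀ k a, P k a → ∃ b, P (k + 1) b ∧ R k a b) :
    ∃ f : ℕ → α, ∀ k, P k (f k) ∧ R k (f k) (f (k + 1)) := by
  obtain ⟨a, ha⟩ := h0
  choose! g hg using h
  let f : ℕ → α := fun k => Nat.rec a (fun k b => g k b) k
  have hf : ∀ k, P k (f k) := fun k => by
    induction k with
    | zero => exact ha
    | succ k ih => exact (hg k _ ih).1
  exact ⟨f, fun k => ⟨hf k, (hg k _ (hf k)).2⟩⟩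

/-- **Hahn–Mazurkiewicz theorem**: a nonempty connected locally connected metrizable compactum is a
continuous image of the unit interval. -/
theorem exists_unitInterval_continuous_surjective (X : Type*) [TopologicalSpace X] [CompactSpace X]
    [TopologicalSpace.MetrizableSpace X] [ConnectedSpace X] [LocallyConnectedSpace X] :
    ∃ f : unitInterval → X, Continuous f ∧ Function.Surjective f := by
  let := TopologicalSpace.metrizableSpaceMetric X
  have hδ : ∀ k : ℕ, ∃ δ > 0, δ ≤ (1 / 2 : ℝ) ^ k ∧
      ∀ x : X, ball x δ ⊆ connectedComponentIn (ball x ((1 / 2 : ℝ) ^ k)) x := fun k => by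
    obtain ⟨δ, h0, h⟩ := exists_ball_subset_connectedComponentIn (X := X)
      (ε := (1 / 2 : ℝ) ^ k) (by positivity)
    exact ⟨min δ ((1 / 2) ^ k), by positivity, min_le_right _ _, fun x =>
      (ball_subset_ball (min_le_left _ _)).trans (h x)⟩
  choose δ hδ0 hδle hδ using hδ
  obtain ⟨p, hp⟩ := exists_dependent_sequence (P := fun k => IsFineSequence (X := X) (δ k))
    (R := fun k => IsRefinement ((1 / 2 : ℝ) ^ k)) (exists_isFineSequence (hδ0 0))
    fun k a ha => ha.exists_refinement (hδ k) (hδ0 (k + 1))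
  -- The step function running through `p k` at uniform speed; the common block length makes
  -- consecutive ones uniformly close.
  let F : ℕ → ℝ → X := fun k t => (p k).2 ⌊t * (p k).1⌋₊
  have hF : ∀ t k, dist (F k t) (F (k + 1) t) ≤ 1 * (1 / 2 : ℝ) ^ k := by
    intro t k
    obtain ⟨N, hN, h1, h2⟩ := (hp k).2
    have : ⌊t * (p k).1⌋₊ = ⌊t * (p (k + 1)).1⌋₊ / N := by
      rw [← Nat.floor_div_natCast, h1]
      push_cast
      rw [← mul_assoc, mul_div_cancel_right₀]
      exact_mod_cast hN.ne'
    simp only [F]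
    rw [this, one_mul]
    exact (h2 _).le
  have hlim : ∀ t, ∃ x, Filter.Tendsto (fun k => F k t) Filter.atTop (nhds x) := fun t =>
    cauchySeq_tendsto_of_complete (cauchySeq_of_le_geometric _ _ (by norm_num) (hF t))
  choose f hf using hlim
  have hFf : ∀ t k, dist (F k t) (f t) ≤ 2 * (1 / 2 : ℝ) ^ k := fun t k => by
    have := dist_le_of_le_geometric_of_tendsto _ _ (by norm_num) (hF t) (hf t) k
    rw [one_mul, show (1 : ℝ) - 1 / 2 = 1 / 2 by norm_num, div_div_eq_mul_div, div_one] at this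
    linarith
  -- `5 = 2 + 1 + 2`: two passages between `f` and `F k`, and at most one step of `p k`.
  have hsmall : ∀ ε > 0, ∃ k : ℕ, 5 * (1 / 2 : ℝ) ^ k < ε := fun ε hε => by
    obtain ⟨k, hk⟩ := exists_pow_lt_of_lt_one (show 0 < ε / 5 by positivity)
      (show (1 / 2 : ℝ) < 1 by norm_num)
    exact ⟨k, by linarith⟩
  have hcont : Continuous fun t : unitInterval => f t := by
    rw [Metric.continuous_iff]
    intro s ε hε
    obtain ⟨k, hk⟩ := hsmall ε hε
    have hM : (0 : ℝ) < (p k).1 := by exact_mod_cast (hp k).1.pos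
    have hnear : ∀ a b : ℝ, 0 ≤ a → a ≤ b → b - a < 1 / (p k).1 →
        dist (F k a) (F k b) ≤ (1 / 2 : ℝ) ^ k := by
      intro a b ha hab h
      rw [lt_div_iff₀ hM, sub_mul] at h
      have h1 : ⌊a * (p k).1⌋₊ ≤ ⌊b * (p k).1⌋₊ := Nat.floor_mono (by gcongr)
      have h2 : ⌊b * (p k).1⌋₊ ≤ ⌊a * (p k).1⌋₊ + 1 := by
        rw [← Nat.floor_add_one (by positivity)]
        exact Nat.floor_mono (by linarith)
      simp only [F]
      rcases h1.eq_or_lt with h3 | h3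
      · rw [h3, dist_self]
        positivity
      · rw [show ⌊b * (p k).1⌋₊ = ⌊a * (p k).1⌋₊ + 1 by omega]
        exact ((hp k).1.step _).le.trans (hδle k)
    refine ⟨1 / (p k).1, by positivity, fun t ht => ?_⟩
    have hst : dist (F k t) (F k s) ≤ (1 / 2 : ℝ) ^ k := by
      rw [Subtype.dist_eq, Real.dist_eq, abs_lt] at ht
      rcases le_total (t : ℝ) s with h | h
      · exact hnear _ _ t.2.1 h (by linarith)
      · rw [dist_comm]
        exact hnear _ _ s.2.1 h (by linarith)
    have h1 := hFf t k
    have h2 := hFf s k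
    rw [dist_comm] at h1
    linarith [dist_triangle4 (f t) (F k t) (F k s) (f s)]
  refine ⟨fun t => f t, hcont, ?_⟩
  rw [← range_eq_univ, ← (isCompact_range hcont).isClosed.closure_eq]
  refine eq_univ_of_forall fun x => Metric.mem_closure_iff.2 fun ε hε => ?_
  obtain ⟨k, hk⟩ := hsmall ε hε
  obtain ⟨i, hi, hx⟩ := (hp k).1.dense x
  have hM : (0 : ℝ) < (p k).1 := by exact_mod_cast (hp k).1.pos
  have ht : (i : ℝ) / (p k).1 ∈ unitInterval :=
    ⟨by positivity, by rw [div_le_one hM]; exact_mod_cast hi.le⟩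
  refine ⟨_, ⟨⟨_, ht⟩, rfl⟩, ?_⟩
  have h1 := hFf ((i : ℝ) / (p k).1) k
  simp only [F] at h1
  rw [div_mul_cancel₀ _ hM.ne', Nat.floor_natCast] at h1
  have h2 := hx.trans_le (hδle k)
  have h3 : (0 : ℝ) < (1 / 2) ^ k := by positivity
  dsimp only
  linarith [dist_triangle x ((p k).2 i) (f ((i : ℝ) / (p k).1))]

/-! ### Continuity in the hyperspace of compacta. -/

/-- The Hilbert cube. -/
abbrev HilbertCube : Type := ℕ → unitInterval

/-- A separation of `K` by disjoint open sets `U`, `V` also separates every compactum near `K`. -/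
theorem isClosed_setOf_isPreconnected {α : Type*} [TopologicalSpace α] [T2Space α] :
    IsClosed {K : NonemptyCompacts α | IsPreconnected (K : Set α)} := by
  rw [← isOpen_compl_iff, isOpen_iff_mem_nhds]
  intro K hK
  rw [mem_compl_iff, mem_ofPred_eq, isPreconnected_closed_iff] at hK
  push Not at hK
  obtain ⟨s, t, hs, ht, hst, hKs, hKt, hd⟩ := hK
  obtain ⟨U, V, hU, hV, hsU, htV, hUV⟩ := SeparatedNhds.of_isCompact_isCompact
    (K.isCompact.inter_right hs) (K.isCompact.inter_right ht) (by
      rw [disjoint_iff_inter_eq_empty, ← hd]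
      ext x
      simp only [mem_inter_iff]
      tauto)
  filter_upwards [(NonemptyCompacts.isOpen_subsets_of_isOpen (hU.union hV)).mem_nhds
      (fun x hx => (hst hx).imp (fun h => hsU ⟨hx, h⟩) fun h => htV ⟨hx, h⟩),
    (NonemptyCompacts.isOpen_inter_nonempty_of_isOpen hU).mem_nhds
      (hKs.mono fun x hx => ⟨hx.1, hsU hx⟩),
    (NonemptyCompacts.isOpen_inter_nonempty_of_isOpen hV).mem_nhds
      (hKt.mono fun x hx => ⟨hx.1, htV hx⟩)] with L h1 h2 h3 hL
  obtain ⟨x, -, hxU, hxV⟩ := hL U V hU hV h1 h2 h3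
  exact hUV.le_bot ⟨hxU, hxV⟩

theorem isClosed_setOf_mem {P α : Type*} [TopologicalSpace P] [TopologicalSpace α] [T2Space α]
    {g : P → NonemptyCompacts α} (hg : Continuous g) : IsClosed {x : P × α | x.2 ∈ g x.1} := by
  rw [← isOpen_compl_iff, isOpen_iff_mem_nhds]
  rintro ⟨p, x⟩ hx
  obtain ⟨U, V, hU, hV, hsU, hxV, hUV⟩ := SeparatedNhds.of_isCompact_isCompact
    (g p).isCompact (isCompact_singleton (x := x)) (by simpa using hx)
  filter_upwards [prod_mem_nhds
    (((NonemptyCompacts.isOpen_subsets_of_isOpen hU).preimage hg).mem_nhds hsU)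
    (hV.mem_nhds (hxV rfl))] with y hy hy'
  exact hUV.le_bot ⟨hy.1 hy', hy.2⟩

/-- The fibers of a closed and open continuous map vary continuously in the hyperspace. -/
theorem exists_continuous_hyperspace_fibers {A B α : Type*} [TopologicalSpace A]
    [TopologicalSpace B] [TopologicalSpace α] {q : A → B} (hqc : IsClosedMap q) (hqo : IsOpenMap q)
    (hK : ∀ b, IsCompact (q ⁻¹' {b})) {e : A → α} (he : Continuous e) :
    ∃ g : range q → NonemptyCompacts α, Continuous g ∧
      ∀ b : range q, (g b : Set α) = e '' (q ⁻¹' {(b : B)}) := by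
  let g : range q → NonemptyCompacts α := fun b =>
    ⟨⟨e '' (q ⁻¹' {(b : B)}), (hK b).image he⟩, by
      obtain ⟨_, a, rfl⟩ := b
      exact ⟨e a, a, rfl, rfl⟩⟩
  have hg : ∀ b : range q, (g b : Set α) = e '' (q ⁻¹' {(b : B)}) := fun b => rfl
  refine ⟨g, ?_, hg⟩
  let : TopologicalSpace (Set α) := .vietoris α
  rw [NonemptyCompacts.isEmbedding_coe.continuous_iff, vietoris.continuous_iff]
  constructor
  -- Upper semicontinuity comes from `q` being closed.
  · intro U hU
    have : ((fun K : NonemptyCompacts α => (K : Set α)) ∘ g) ⁻¹' U.powerset =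
        Subtype.val ⁻¹' (q '' (e ⁻¹' Uᶜ))ᶜ := by
      ext b
      simp only [Function.comp_apply, mem_preimage, mem_powerset_iff, hg, image_subset_iff,
        mem_compl_iff, mem_image, not_exists, not_and]
      exact ⟨fun h a ha hab => ha (h hab), fun h a hab => by_contra fun ha => h a ha hab⟩
    rw [this]
    exact (hqc _ (hU.isClosed_compl.preimage he)).isOpen_compl.preimage continuous_subtype_val
  -- Lower semicontinuity comes from `q` being open.
  · intro F hF
    have : ((fun K : NonemptyCompacts α => (K : Set α)) ∘ g) ⁻¹' F.powerset =
        Subtype.val ⁻¹' (q '' (e ⁻¹' Fᶜ))ᶜ := by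
      ext b
      simp only [Function.comp_apply, mem_preimage, mem_powerset_iff, hg, image_subset_iff,
        mem_compl_iff, mem_image, not_exists, not_and]
      exact ⟨fun h a ha hab => ha (h hab), fun h a hab => by_contra fun ha => h a ha hab⟩
    rw [this]
    exact (hqo _ (hF.isOpen_compl.preimage he)).isClosed_compl.preimage continuous_subtype_val

/-! ### Polish parametrizations of continuous images. -/

/-- The map `g` lists, up to homeomorphism, exactly the nonempty members of `C`. -/
structure Parametrizes {P : Type*} [TopologicalSpace P] (g : P → NonemptyCompacts HilbertCube)
    (C : Set TopCat.{u}) : Prop where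
  continuous : Continuous g
  exists_mem : ∀ p, ∃ X ∈ C, Nonempty ((g p : Set HilbertCube) ≃ₜ X)
  exists_param : ∀ X ∈ C, Nonempty X → ∃ p, Nonempty (X ≃ₜ (g p : Set HilbertCube))

theorem Parametrizes.exists_nat_nat {P : Type*} [TopologicalSpace P] [PolishSpace P] [Nonempty P]
    {g : P → NonemptyCompacts HilbertCube} {C : Set TopCat.{u}} (hg : Parametrizes g C) :
    ∃ g' : (ℕ → ℕ) → NonemptyCompacts HilbertCube, Parametrizes g' C := by
  obtain ⟨f, hf, hs⟩ := PolishSpace.exists_nat_nat_continuous_surjective P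
  refine ⟨g ∘ f, hg.continuous.comp hf, fun p => hg.exists_mem _, fun X hX hne => ?_⟩
  obtain ⟨p, hp⟩ := hg.exists_param X hX hne
  obtain ⟨p, rfl⟩ := hs p
  exact ⟨p, hp⟩

/-- The parameters are pairs of a nonempty fiber and a self-map of the cube. Compactness of `X`
makes its copy in the cube closed, so Tietze extends any map `X → HilbertCube` to such a self-map.
-/
theorem IsStronglyPolishable.exists_continuous_ranges {C : Set TopCat.{u}}
    (hC : C ⊆ metrizableCompacta) (h : IsStronglyPolishable C) :
    ∃ (P : Type u) (_ : TopologicalSpace P) (g : P → NonemptyCompacts HilbertCube),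
      PolishSpace P ∧ Continuous g ∧
      (∀ p, ∃ X ∈ C, ∃ f : X → HilbertCube, Continuous f ∧ range f = g p) ∧
      ∀ X ∈ C, Nonempty X → ∀ f : X → HilbertCube, Continuous f → ∃ p, range f = g p := by
  obtain ⟨A, B, q, hA, hB, ⟨hqc, hqo, -⟩, hq, hfib, hfib'⟩ := h
  have hK : ∀ b, IsCompact (q ⁻¹' {b}) := fun b => by
    obtain ⟨Y, hY, ⟨φ⟩⟩ := hfib _ ⟨b, rfl⟩
    have := (hC hY).1
    exact isCompact_iff_compactSpace.2 φ.symm.compactSpace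
  let := metrizableSpaceMetric A
  obtain ⟨e, he⟩ := Metric.PiNatEmbed.exists_embedding_to_hilbert_cube (X := A)
  obtain ⟨k, hk, hk'⟩ := exists_continuous_hyperspace_fibers hqc hqo hK he.continuous
  have : PolishSpace (range q) := hqc.isClosed_range.polishSpace
  refine ⟨range q × C(HilbertCube, HilbertCube), inferInstance, fun p => (k p.1).map p.2 p.2.continuous,
    inferInstance, ?_, ?_, ?_⟩
  · exact Continuous.nonemptyCompacts_map'
      (f := fun p : range q × C(HilbertCube, HilbertCube) => k p.1) (g := fun p => p.2)
      (hk.comp continuous_fst) (by unfold Function.uncurry; fun_prop)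
  · rintro ⟨b, F⟩
    obtain ⟨Y, hY, ⟨φ⟩⟩ := hfib _ ⟨b, rfl⟩
    refine ⟨Y, hY, fun y => F (e (φ.symm y).1), by fun_prop, ?_⟩
    rw [NonemptyCompacts.coe_map, hk']
    ext x
    constructor
    · rintro ⟨y, rfl⟩
      exact ⟨_, ⟨_, (φ.symm y).2, rfl⟩, rfl⟩
    · rintro ⟨_, ⟨a, ha, rfl⟩, rfl⟩
      exact ⟨φ ⟨a, ha⟩, by simp⟩
  · intro X hX ⟨x₀⟩ f hf
    obtain ⟨_, ⟨b, rfl⟩, ⟨φ⟩⟩ := hfib' X hX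
    have := (hC hX).1
    have hψ : IsClosedEmbedding fun x => e (φ x).1 :=
      (he.comp (IsEmbedding.subtypeVal.comp φ.isEmbedding)).continuous.isClosedEmbedding
        (he.comp (IsEmbedding.subtypeVal.comp φ.isEmbedding)).injective
    obtain ⟨F, hF⟩ := ContinuousMap.exists_extension' hψ ⟨f, hf⟩
    have hF' : ∀ x, F (e (φ x).1) = f x := congrFun hF
    refine ⟨(⟨b, (φ x₀).1, (φ x₀).2⟩, F), ?_⟩
    rw [NonemptyCompacts.coe_map, hk']
    ext y
    constructor
    · rintro ⟨x, rfl⟩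
      exact ⟨_, ⟨_, (φ x).2, rfl⟩, hF' x⟩
    · rintro ⟨_, ⟨a, ha, rfl⟩, rfl⟩
      exact ⟨φ.symm ⟨a, ha⟩, by simp [← hF']⟩

theorem of_ulift_mem_metrizableCompacta {X : Type} [TopologicalSpace X] [CompactSpace X]
    [MetrizableSpace X] : TopCat.of (ULift.{u} X) ∈ metrizableCompacta.{u} :=
  ⟨inferInstanceAs (CompactSpace (ULift X)), Homeomorph.ulift.isEmbedding.metrizableSpace⟩

theorem exists_range_homeomorph {X Y : Type*} [TopologicalSpace X] [TopologicalSpace Y]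
    [CompactSpace Y] [MetrizableSpace Y] {f : X → Y} (hf : Continuous f)
    (hs : Function.Surjective f) :
    ∃ f' : X → HilbertCube, Continuous f' ∧ Nonempty (Y ≃ₜ range f') := by
  let := metrizableSpaceMetric Y
  obtain ⟨e, he⟩ := Metric.PiNatEmbed.exists_embedding_to_hilbert_cube (X := Y)
  refine ⟨e ∘ f, he.continuous.comp hf, ?_⟩
  rw [hs.range_comp]
  exact ⟨he.toHomeomorph⟩

theorem mapsOnto_ulift_range {X : TopCat.{u}} {f : X → HilbertCube} (hf : Continuous f)
    {K : Set HilbertCube} (hK : range f = K) : MapsOnto X (TopCat.of (ULift.{u} K)) := by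
  subst hK
  refine ⟨fun x => ⟨⟨f x, x, rfl⟩⟩, by fun_prop, ?_⟩
  rintro ⟨⟨_, x, rfl⟩⟩
  exact ⟨x, rfl⟩

theorem IsStronglyPolishable.parametrizes_images {C : Set TopCat.{u}}
    (hC : C ⊆ metrizableCompacta) (h : IsStronglyPolishable C) {X : TopCat.{u}} (hX : X ∈ C)
    (hne : Nonempty X) : (∃ g : (ℕ → ℕ) → NonemptyCompacts HilbertCube,
      Parametrizes g (continuousImages C ∩ metrizableCompacta)) ∧
    ∃ g : (ℕ → ℕ) → NonemptyCompacts HilbertCube,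
      Parametrizes g (continuousImages C ∩ metrizableContinua) := by
  obtain ⟨P, _, g, _, hg, hmem, hpar⟩ := h.exists_continuous_ranges hC
  have hmem' : ∀ p, TopCat.of (ULift.{u} (g p : Set HilbertCube)) ∈
      continuousImages C ∩ metrizableCompacta := fun p => by
    obtain ⟨X, hX, f, hf, hfp⟩ := hmem p
    have : CompactSpace (g p : Set HilbertCube) := isCompact_iff_compactSpace.1 (g p).isCompact
    exact ⟨⟨X, hX, mapsOnto_ulift_range hf hfp⟩, of_ulift_mem_metrizableCompacta⟩
  have hpar' : ∀ Y ∈ continuousImages C ∩ metrizableCompacta, Nonempty Y →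
      ∃ p, Nonempty (Y ≃ₜ (g p : Set HilbertCube)) := by
    rintro Y ⟨⟨X, hX, f, hf, hs⟩, hY1, hY2⟩ hYne
    obtain ⟨f', hf', hφ⟩ := exists_range_homeomorph hf hs
    obtain ⟨p, hp⟩ := hpar X hX (hYne.map fun y => (hs y).choose) f' hf'
    exact ⟨p, hp ▸ hφ⟩
  have hP : ∃ p, IsPreconnected (g p : Set HilbertCube) := by
    -- A constant map yields a one-point value, so the set of connected parameters is nonempty.
    obtain ⟨p, hp⟩ := hpar X hX hne (fun _ _ => 0) continuous_const
    refine ⟨p, ?_⟩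
    rw [← hp, range_const]
    exact isPreconnected_singleton
  obtain ⟨p₀, hp₀⟩ := hP
  have : Nonempty P := ⟨p₀⟩
  refine ⟨Parametrizes.exists_nat_nat ⟨hg, fun p => ⟨_, hmem' p, ⟨Homeomorph.ulift.symm⟩⟩, hpar'⟩, ?_⟩
  have : PolishSpace {p | IsPreconnected (g p : Set HilbertCube)} :=
    (isClosed_setOf_isPreconnected.preimage hg).polishSpace
  have : Nonempty {p | IsPreconnected (g p : Set HilbertCube)} := ⟨⟨p₀, hp₀⟩⟩
  refine Parametrizes.exists_nat_nat (g := fun p : {p | IsPreconnected (g p : Set HilbertCube)} => g p)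
    ⟨hg.comp continuous_subtype_val, fun p => ⟨_, ⟨(hmem' p).1, (hmem' p).2, ?_⟩,
      ⟨Homeomorph.ulift.symm⟩⟩, fun Y hY hYne => ?_⟩
  · have : PreconnectedSpace (g p : Set HilbertCube) := isPreconnected_iff_preconnectedSpace.1 p.2
    exact Homeomorph.ulift.symm.surjective.denseRange.preconnectedSpace Homeomorph.ulift.symm.continuous
  · obtain ⟨p, ⟨φ⟩⟩ := hpar' Y ⟨hY.1, hY.2.1⟩ hYne
    have : PreconnectedSpace Y := hY.2.2
    refine ⟨⟨p, ?_⟩, ⟨φ⟩⟩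
    rw [mem_ofPred_eq, isPreconnected_iff_preconnectedSpace]
    exact φ.surjective.denseRange.preconnectedSpace φ.continuous

/-! ### From families of nonempty fibers to compositions. -/

/-- A point if `C` has an empty member, and empty otherwise. -/
abbrev EmptyMember (C : Set TopCat.{u}) : Type u :=
  {_x : PUnit.{u + 1} // ∃ X ∈ C, IsEmpty X}

/-- `q` realizes the nonempty members of `C` as fibers. -/
structure RealizesNonempty {A B : Type u} [TopologicalSpace A] [TopologicalSpace B] (q : A → B)
    (C : Set TopCat.{u}) : Prop where
  continuous : Continuous q
  exists_mem : ∀ b, ∃ X ∈ C, Nonempty (q ⁻¹' {b} ≃ₜ X)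
  exists_fiber : ∀ X ∈ C, Nonempty X → ∃ b, Nonempty (X ≃ₜ q ⁻¹' {b})

/-- An isolated point outside the range supplies the empty fiber exactly when `C` needs one. -/
theorem RealizesNonempty.isComposition {A B : Type u} [TopologicalSpace A] [TopologicalSpace B]
    {q : A → B} {C : Set TopCat.{u}} (h : RealizesNonempty q C) :
    IsComposition (fun a => (Sum.inl (q a) : B ⊕ EmptyMember C)) C := by
  have hinl : ∀ b, (fun a => (Sum.inl (q a) : B ⊕ EmptyMember C)) ⁻¹' {Sum.inl b} = q ⁻¹' {b} :=
    fun b => by ext; simp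
  have hinr : ∀ t, IsEmpty ((fun a => (Sum.inl (q a) : B ⊕ EmptyMember C)) ⁻¹' {Sum.inr t}) :=
    fun t => isEmpty_coe_sort.2 (by ext; simp)
  refine ⟨continuous_inl.comp h.continuous, ?_, fun X hX => ?_⟩
  · rintro _ ⟨b | t, rfl⟩
    · obtain ⟨X, hX, ⟨φ⟩⟩ := h.exists_mem b
      exact ⟨X, hX, ⟨(Homeomorph.setCongr (hinl b)).trans φ⟩⟩
    · obtain ⟨X, hX, hXe⟩ := t.2
      have := hinr t
      exact ⟨X, hX, ⟨Homeomorph.empty⟩⟩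
  · rcases isEmpty_or_nonempty X with hXe | hXe
    · have := hinr ⟨PUnit.unit, X, hX, hXe⟩
      exact ⟨_, ⟨Sum.inr ⟨PUnit.unit, X, hX, hXe⟩, rfl⟩, ⟨Homeomorph.empty⟩⟩
    · obtain ⟨b, ⟨φ⟩⟩ := h.exists_fiber X hX hXe
      exact ⟨_, ⟨Sum.inl b, rfl⟩, ⟨φ.trans (Homeomorph.setCongr (hinl b).symm)⟩⟩

theorem RealizesNonempty.isStronglyPolishable {A B : Type u} [TopologicalSpace A]
    [TopologicalSpace B] [PolishSpace A] [PolishSpace B] {q : A → B} {C : Set TopCat.{u}}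
    (h : RealizesNonempty q C) (hc : IsClosedMap q) (ho : IsOpenMap q)
    (hs : Function.Surjective q) : IsStronglyPolishable C := by
  have : PolishSpace (EmptyMember C) := (isClosed_discrete {_x | ∃ X ∈ C, IsEmpty X}).polishSpace
  refine ⟨TopCat.of A, TopCat.of (B ⊕ EmptyMember C), fun a => Sum.inl (q a), ‹_›,
    inferInstanceAs (PolishSpace (B ⊕ EmptyMember C)),
    ⟨isClosedMap_inl.comp hc, isOpenMap_inl.comp ho, ?_⟩, h.isComposition⟩
  rintro (b | t) hx (b' | t') hx'
  · obtain ⟨a, rfl⟩ := hs b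
    exact absurd ⟨a, rfl⟩ hx
  · obtain ⟨a, rfl⟩ := hs b
    exact absurd ⟨a, rfl⟩ hx
  · obtain ⟨a, rfl⟩ := hs b'
    exact absurd ⟨a, rfl⟩ hx'
  · exact congrArg Sum.inr (Subsingleton.elim _ _)

theorem RealizesNonempty.isCompactifiable {A B : Type u} [TopologicalSpace A]
    [TopologicalSpace B] [CompactSpace A] [CompactSpace B] [MetrizableSpace A] [MetrizableSpace B]
    {q : A → B} {C : Set TopCat.{u}} (h : RealizesNonempty q C) : IsCompactifiable C := by
  have : SecondCountableTopology B := by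
    let := metrizableSpaceMetric B
    infer_instance
  exact ⟨TopCat.of A, TopCat.of (B ⊕ EmptyMember C), fun a => Sum.inl (q a), ⟨‹_›, ‹_›⟩,
    ⟨inferInstanceAs (CompactSpace (B ⊕ EmptyMember C)),
      metrizableSpace_of_t3_secondCountable (B ⊕ EmptyMember C)⟩, h.isComposition⟩

theorem realizesNonempty_pempty {C : Set TopCat.{u}} (hC : ∀ X ∈ C, IsEmpty X) :
    RealizesNonempty (id : PEmpty.{u + 1} → PEmpty.{u + 1}) C where
  continuous := continuous_id
  exists_mem b := b.elim
  exists_fiber X hX hne := (hne.elim (hC X hX).false).elim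

theorem realizesNonempty_punit {C : Set TopCat.{u}} (hC : ∀ X ∈ C, Subsingleton X)
    {X : TopCat.{u}} (hX : X ∈ C) (hne : Nonempty X) :
    RealizesNonempty (id : PUnit.{u + 1} → PUnit.{u + 1}) C := by
  have key : ∀ Y ∈ C, Nonempty Y →
      Nonempty ((id : PUnit.{u + 1} → PUnit.{u + 1}) ⁻¹' {PUnit.unit} ≃ₜ Y) := fun Y hY hYne => by
    have := hC Y hY
    obtain ⟨y⟩ := hYne
    exact ⟨{ toFun := fun _ => y
             invFun := fun _ => ⟨PUnit.unit, rfl⟩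
             left_inv := fun _ => Subsingleton.elim _ _
             right_inv := fun _ => Subsingleton.elim _ _
             continuous_toFun := continuous_const
             continuous_invFun := continuous_const }⟩
  exact ⟨continuous_id, fun _ => ⟨X, hX, key X hX hne⟩,
    fun Y hY hYne => ⟨PUnit.unit, (key Y hY hYne).map Homeomorph.symm⟩⟩

/-- The projection of a relation to its first coordinate, in a given universe. -/
def relationProj {P Y : Type} (S : Set (P × Y)) (a : ULift.{u} S) : ULift.{u} P :=
  ⟨a.down.1.1⟩

theorem continuous_relationProj {P Y : Type} [TopologicalSpace P] [TopologicalSpace Y]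
    (S : Set (P × Y)) : Continuous (relationProj.{u} S) := by
  unfold relationProj
  fun_prop

/-- The fibers of the projection of a relation are its sections. -/
def relationProjFiber {P Y : Type} [TopologicalSpace P] [TopologicalSpace Y]
    (S : Set (P × Y)) (b : ULift.{u} P) :
    relationProj.{u} S ⁻¹' {b} ≃ₜ {y | (b.down, y) ∈ S} where
  toFun a := ⟨a.1.down.1.2, by
    obtain ⟨⟨⟨⟨p, y⟩, h⟩⟩, rfl⟩ := a
    exact h⟩
  invFun y := ⟨⟨⟨(b.down, y), y.2⟩⟩, rfl⟩
  left_inv a := by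
    obtain ⟨⟨⟨⟨p, y⟩, h⟩⟩, rfl⟩ := a
    rfl
  right_inv _ := rfl
  continuous_toFun := by fun_prop
  continuous_invFun := by fun_prop

/-- Lower semicontinuity of `g`: if `g p` meets an open set, so does `g p'` for `p'` near `p`. -/
theorem isOpenMap_relationProj {P Y : Type} [TopologicalSpace P] [TopologicalSpace Y]
    {g : P → NonemptyCompacts Y} (hg : Continuous g) :
    IsOpenMap (relationProj.{u} {x : P × Y | x.2 ∈ g x.1}) := by
  refine IsOpenMap.of_nhds_le fun a => ?_
  obtain ⟨⟨⟨p, y⟩, hy⟩⟩ := a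
  intro s hs
  rw [Filter.mem_map] at hs
  have h1 : (fun x : {x : P × Y | x.2 ∈ g x.1} => ULift.up.{u} x) ⁻¹'
      (relationProj.{u} {x : P × Y | x.2 ∈ g x.1} ⁻¹' s) ∈ 𝓝 (⟨(p, y), hy⟩ : {x : P × Y | x.2 ∈ g x.1}) :=
    continuous_uliftUp.continuousAt hs
  rw [mem_nhds_subtype] at h1
  obtain ⟨t, ht, hts⟩ := h1
  obtain ⟨N, hN, V, hV, hNV⟩ := mem_nhds_prod_iff.1 ht
  have h2 : {p' | p' ∈ N ∧ ((g p' : Set Y) ∩ interior V).Nonempty} ∈ 𝓝 p :=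
    Filter.inter_mem hN (((NonemptyCompacts.isOpen_inter_nonempty_of_isOpen
      isOpen_interior).preimage hg).mem_nhds ⟨y, hy, mem_interior_iff_mem_nhds.2 hV⟩)
  have h3 : ULift.down.{u} ⁻¹' {p' | p' ∈ N ∧ ((g p' : Set Y) ∩ interior V).Nonempty} ∈
      𝓝 (ULift.up.{u} p) := continuous_uliftDown.continuousAt h2
  filter_upwards [h3]
  rintro ⟨p'⟩ ⟨hp', y', hy', hyV⟩
  exact @hts ⟨(p', y'), hy'⟩ (hNV ⟨hp', interior_subset hyV⟩)

theorem Parametrizes.isStronglyPolishable {P : Type} [TopologicalSpace P] [PolishSpace P]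
    {g : P → NonemptyCompacts HilbertCube} {C : Set TopCat.{u}} (h : Parametrizes g C) :
    IsStronglyPolishable C := by
  set S : Set (P × HilbertCube) := {x | x.2 ∈ g x.1} with hS
  have hSc : IsClosed S := isClosed_setOf_mem h.continuous
  have : PolishSpace S := hSc.polishSpace
  have : PolishSpace (ULift.{u} S) := Homeomorph.ulift.isClosedEmbedding.polishSpace
  have : PolishSpace (ULift.{u} P) := Homeomorph.ulift.isClosedEmbedding.polishSpace
  have hR : RealizesNonempty (relationProj.{u} S) C := by
    refine ⟨continuous_relationProj S, fun b => ?_, fun X hX hne => ?_⟩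
    · obtain ⟨X, hX, ⟨φ⟩⟩ := h.exists_mem b.down
      exact ⟨X, hX, ⟨(relationProjFiber S b).trans φ⟩⟩
    · obtain ⟨p, ⟨φ⟩⟩ := h.exists_param X hX hne
      exact ⟨⟨p⟩, ⟨φ.trans (relationProjFiber S ⟨p⟩).symm⟩⟩
  refine hR.isStronglyPolishable ?_ (isOpenMap_relationProj h.continuous) fun b => ?_
  -- Projection along the compact cube is closed.
  · exact Homeomorph.ulift.symm.isClosedMap.comp ((isClosedMap_fst_of_compactSpace.comp
      hSc.isClosedEmbedding_subtypeVal.isClosedMap).comp Homeomorph.ulift.isClosedMap)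
  · obtain ⟨y, hy⟩ := (g b.down).nonempty
    exact ⟨⟨⟨(b.down, y), hy⟩⟩, rfl⟩

/-! ### Approximation of compacta in the cube by finite unions of boxes. -/

/-- The `k`-th of the `2 ^ n` affine contractions of the unit interval onto its dyadic pieces. -/
noncomputable def dyadicContraction (n : ℕ) (k : Fin (2 ^ n)) (x : unitInterval) : unitInterval :=
  ⟨((k : ℝ) + x) / 2 ^ n, by
    have h1 : ((k : ℕ) : ℝ) + 1 ≤ 2 ^ n := by exact_mod_cast k.2
    have h2 := x.2.1
    have h3 := x.2.2
    constructor
    · positivity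
    · rw [div_le_one (by positivity)]
      linarith⟩

theorem continuous_dyadicContraction (n : ℕ) (k : Fin (2 ^ n)) :
    Continuous (dyadicContraction n k) := by
  unfold dyadicContraction
  fun_prop

theorem mem_range_dyadicContraction {n : ℕ} {k : Fin (2 ^ n)} {y : unitInterval} :
    y ∈ range (dyadicContraction n k) ↔ (k : ℝ) ≤ y * 2 ^ n ∧ (y : ℝ) * 2 ^ n ≤ k + 1 := by
  constructor
  · rintro ⟨x, rfl⟩
    have h2 := x.2.1
    have h3 := x.2.2
    rw [dyadicContraction, div_mul_cancel₀ _ (by positivity)]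
    constructor <;> linarith
  · rintro ⟨h1, h2⟩
    refine ⟨⟨y * 2 ^ n - k, by linarith, by linarith⟩, Subtype.ext ?_⟩
    simp [dyadicContraction]

theorem exists_mem_range_dyadicContraction (n : ℕ) (y : unitInterval) :
    ∃ k, y ∈ range (dyadicContraction n k) := by
  by_cases hy : (y : ℝ) * 2 ^ n < 2 ^ n
  · have h0 : 0 ≤ (y : ℝ) * 2 ^ n := mul_nonneg y.2.1 (by positivity)
    refine ⟨⟨⌊(y : ℝ) * 2 ^ n⌋₊, ?_⟩, mem_range_dyadicContraction.2
      ⟨Nat.floor_le h0, (Nat.lt_floor_add_one _).le⟩⟩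
    rw [Nat.floor_lt h0]
    exact_mod_cast hy
  -- The endpoint `y = 1`, where the floor would overshoot, lies in the last piece.
  · have h1 : (y : ℝ) * 2 ^ n = 2 ^ n :=
      le_antisymm (mul_le_of_le_one_left (by positivity) y.2.2) (not_lt.1 hy)
    have h2 : 1 ≤ 2 ^ n := Nat.one_le_two_pow
    refine ⟨⟨2 ^ n - 1, by omega⟩, mem_range_dyadicContraction.2 ?_⟩
    rw [h1]
    push_cast [Nat.cast_sub h2]
    constructor <;> linarith

/-- The affine embedding of the Hilbert cube onto a box of the `n`-th dyadic grid. -/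
noncomputable def boxMap (n : ℕ) (κ : Fin n → Fin (2 ^ n)) (x : HilbertCube) : HilbertCube :=
  fun i => if h : i < n then dyadicContraction n (κ ⟨i, h⟩) (x i) else x i

theorem continuous_boxMap (n : ℕ) (κ : Fin n → Fin (2 ^ n)) : Continuous (boxMap n κ) := by
  refine continuous_pi fun i => ?_
  unfold boxMap
  split_ifs with h
  · exact (continuous_dyadicContraction _ _).comp (continuous_apply i)
  · exact continuous_apply i

theorem mem_range_boxMap {n : ℕ} {κ : Fin n → Fin (2 ^ n)} {y : HilbertCube} :
    y ∈ range (boxMap n κ) ↔ ∀ i : Fin n, y i ∈ range (dyadicContraction n (κ i)) := by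
  constructor
  · rintro ⟨x, rfl⟩ i
    exact ⟨x i, by simp [boxMap]⟩
  · intro h
    choose x hx using h
    refine ⟨fun i => if h : i < n then x ⟨i, h⟩ else y i, funext fun i => ?_⟩
    by_cases hi : i < n
    · simpa [boxMap, hi] using hx ⟨i, hi⟩
    · simp [boxMap, hi]

/-- The union of the boxes of the `n`-th dyadic grid that meet `K`. -/
def gridHull (n : ℕ) (K : Set HilbertCube) : Set HilbertCube :=
  {y | ∃ κ, y ∈ range (boxMap n κ) ∧ (K ∩ range (boxMap n κ)).Nonempty}

theorem subset_gridHull (n : ℕ) (K : Set HilbertCube) : K ⊆ gridHull n K := by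
  intro y hy
  choose κ hκ using fun i : Fin n => exists_mem_range_dyadicContraction n (y i)
  have := mem_range_boxMap.2 hκ
  exact ⟨κ, this, y, hy, this⟩

theorem gridHull_succ_subset (n : ℕ) (K : Set HilbertCube) :
    gridHull (n + 1) K ⊆ gridHull n K := by
  have key : ∀ κ : Fin (n + 1) → Fin (2 ^ (n + 1)), ∃ κ' : Fin n → Fin (2 ^ n),
      range (boxMap (n + 1) κ) ⊆ range (boxMap n κ') := by
    intro κ
    -- Halving the index gives the parent dyadic interval; the last coordinate becomes free.
    refine ⟨fun i => ⟨κ i.castSucc / 2, by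
      have h := (κ i.castSucc).2
      generalize ((κ i.castSucc : Fin _) : ℕ) = m at h ⊢
      rw [pow_succ] at h
      omega⟩, fun y hy => mem_range_boxMap.2 fun i => mem_range_dyadicContraction.2 ?_⟩
    obtain ⟨h1, h2⟩ := mem_range_dyadicContraction.1 (mem_range_boxMap.1 hy i.castSucc)
    dsimp only
    generalize ((κ i.castSucc : Fin _) : ℕ) = m at h1 h2 ⊢
    rw [Fin.val_castSucc, pow_succ, ← mul_assoc] at h1 h2
    generalize (y i : ℝ) * 2 ^ n = t at h1 h2 ⊢
    have h3 : ((m / 2 : ℕ) : ℝ) * 2 ≤ m := by exact_mod_cast Nat.div_mul_le_self m 2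
    have h4 : (m : ℝ) + 1 ≤ (m / 2 : ℕ) * 2 + 2 := by
      have : m + 1 ≤ m / 2 * 2 + 2 := by omega
      exact_mod_cast this
    constructor <;> linarith
  rintro y ⟨κ, hy, hK⟩
  obtain ⟨κ', h⟩ := key κ
  exact ⟨κ', h hy, hK.mono (inter_subset_inter_right _ h)⟩

theorem antitone_gridHull (K : Set HilbertCube) : Antitone fun n => gridHull n K :=
  antitone_nat_of_succ_le fun n => gridHull_succ_subset n K

/-- A point `y` of all hulls shares its `n`-th box with some `a n ∈ K`. Their first `n` coordinates
differ by at most `2⁻ⁿ`, so `a` converges to `y`. -/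
theorem iInter_gridHull {K : Set HilbertCube} (hK : IsClosed K) : ⋂ n, gridHull n K = K := by
  refine subset_antisymm (fun y hy => ?_) (subset_iInter fun n => subset_gridHull n K)
  rw [mem_iInter] at hy
  choose κ hκ a haK ha using hy
  refine hK.mem_of_tendsto (f := a) (b := Filter.atTop) ?_ (Filter.Eventually.of_forall haK)
  refine tendsto_pi_nhds.2 fun i => ?_
  rw [tendsto_iff_dist_tendsto_zero]
  refine squeeze_zero' (Filter.Eventually.of_forall fun _ => dist_nonneg) ?_
    (tendsto_pow_atTop_nhds_zero_of_lt_one (r := (1 / 2 : ℝ)) (by norm_num) (by norm_num))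
  filter_upwards [Filter.eventually_gt_atTop i] with n hn
  obtain ⟨h1, h2⟩ := mem_range_dyadicContraction.1 (mem_range_boxMap.1 (hκ n) ⟨i, hn⟩)
  obtain ⟨h3, h4⟩ := mem_range_dyadicContraction.1 (mem_range_boxMap.1 (ha n) ⟨i, hn⟩)
  dsimp only at h1 h2 h3 h4
  rw [Subtype.dist_eq, Real.dist_eq, one_div, inv_pow, ← one_div, le_div_iff₀ (by positivity),
    ← abs_of_pos (show (0 : ℝ) < 2 ^ n by positivity), ← abs_mul, abs_le, sub_mul]
  constructor <;> linarith

/-- There are finitely many boxes, and meeting a given closed box is a closed condition on `K`. -/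
theorem isClosed_setOf_mem_gridHull (n : ℕ) :
    IsClosed {x : NonemptyCompacts HilbertCube × HilbertCube | x.2 ∈ gridHull n x.1} := by
  have : {x : NonemptyCompacts HilbertCube × HilbertCube | x.2 ∈ gridHull n x.1} =
      ⋃ κ : Fin n → Fin (2 ^ n), {K : NonemptyCompacts HilbertCube |
        ((K : Set HilbertCube) ∩ range (boxMap n κ)).Nonempty} ×ˢ range (boxMap n κ) := by
    ext x
    simp [gridHull, and_comm]
  rw [this]
  have hc : ∀ κ, IsClosed (range (boxMap n κ)) := fun κ =>
    (isCompact_range (continuous_boxMap n κ)).isClosed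
  exact isClosed_iUnion_of_finite fun κ =>
    (NonemptyCompacts.isClosed_inter_nonempty_of_isClosed (hc κ)).prod (hc κ)

instance : LocallyConnectedSpace unitInterval :=
  have : LocallyPathConnectedSpace unitInterval := (convex_Icc (0 : ℝ) 1).locallyPathConnectedSpace
  inferInstance

theorem isCompact_gridHull (n : ℕ) (K : Set HilbertCube) : IsCompact (gridHull n K) := by
  have : gridHull n K =
      ⋃ κ : {κ // (K ∩ range (boxMap n κ)).Nonempty}, range (boxMap n κ) := by
    ext x
    simp [gridHull, and_comm]
  rw [this]
  exact isCompact_iUnion fun κ => isCompact_range (continuous_boxMap n κ)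

theorem isPreconnected_gridHull (n : ℕ) {K : Set HilbertCube} (hK : IsPreconnected K) :
    IsPreconnected (gridHull n K) := by
  rcases K.eq_empty_or_nonempty with rfl | ⟨a, ha⟩
  · have : gridHull n ∅ = ∅ := by simp [gridHull]
    rw [this]
    exact isPreconnected_empty
  refine isPreconnected_of_forall a ?_
  rintro y ⟨κ, hy, hκ⟩
  exact ⟨K ∪ range (boxMap n κ), union_subset (subset_gridHull n K) fun z hz => ⟨κ, hz, hκ⟩,
    Or.inl ha, Or.inr hy, hK.union' hκ (isPreconnected_range (continuous_boxMap n κ))⟩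

theorem locallyConnectedSpace_of_surjective {X Y : Type*} [TopologicalSpace X] [TopologicalSpace Y]
    [CompactSpace X] [T2Space Y] [LocallyConnectedSpace X] {f : X → Y} (hf : Continuous f)
    (hs : Function.Surjective f) : LocallyConnectedSpace Y :=
  (hf.isClosedMap.isQuotientMap hf hs).isCoinducing.locallyConnectedSpace

/-- The hull is a continuous image of a finite disjoint union of Hilbert cubes. -/
theorem locallyConnectedSpace_gridHull (n : ℕ) (K : Set HilbertCube) :
    LocallyConnectedSpace (gridHull n K) := by
  let D := {κ : Fin n → Fin (2 ^ n) // (K ∩ range (boxMap n κ)).Nonempty}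
  let f : D × HilbertCube → gridHull n K := fun x => ⟨boxMap n x.1 x.2, x.1, ⟨x.2, rfl⟩, x.1.2⟩
  have : CompactSpace D := Finite.compactSpace
  refine locallyConnectedSpace_of_surjective (f := f) ?_ ?_
  · rw [continuous_prod_of_discrete_left]
    exact fun κ => (continuous_boxMap n κ).subtype_mk _
  · rintro ⟨_, κ, ⟨x, rfl⟩, hκ⟩
    exact ⟨(⟨κ, hκ⟩, x), rfl⟩

/-! ### Compactifying a Baire-parametrized family of continua. -/

/-- The coordinatewise embedding of the Baire space into a metrizable compactum. -/
def baireEmbedding (p : ℕ → ℕ) : ℕ → OnePoint ℕ := fun i => (p i : OnePoint ℕ)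

theorem isEmbedding_baireEmbedding : IsEmbedding baireEmbedding :=
  IsEmbedding.piMap fun _ => OnePoint.isOpenEmbedding_coe.isEmbedding

theorem exists_baireEmbedding_eq {x : ℕ → OnePoint ℕ} (hx : ∀ k, x k ≠ OnePoint.infty) :
    ∃ p, baireEmbedding p = x := by
  choose p hp using fun k => OnePoint.ne_infty_iff_exists.1 (hx k)
  exact ⟨p, funext hp⟩

/-- Taking the closure of the graph adds no point over the embedded copy of `P`, so the original
fibers survive. -/
theorem eq_of_mem_closure_graph {P H Z : Type*} [TopologicalSpace P] [TopologicalSpace H]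
    [TopologicalSpace Z] [FrechetUrysohnSpace (H × Z)] [T2Space Z] {h : P → H} (hh : IsEmbedding h)
    {g : P → Z} (hg : Continuous g) {p : P} {z : Z}
    (hz : (h p, z) ∈ closure (range fun p => (h p, g p))) : z = g p := by
  obtain ⟨u, hu, hlim⟩ := mem_closure_iff_seq_limit.1 hz
  choose v hv using hu
  obtain rfl : (fun n => (h (v n), g (v n))) = u := funext hv
  have h1 : Filter.Tendsto v Filter.atTop (𝓝 p) :=
    hh.tendsto_nhds_iff.2 ((continuous_fst.tendsto _).comp hlim)
  exact tendsto_nhds_unique ((continuous_snd.tendsto _).comp hlim) ((hg.tendsto p).comp h1)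

/-- A class that is parametrized by continua and contains copies of all Peano continua is
compactifiable. -/
theorem Parametrizes.isCompactifiable {g : (ℕ → ℕ) → NonemptyCompacts HilbertCube}
    {C : Set TopCat.{u}} (h : Parametrizes g C) (hconn : ∀ p, IsPreconnected (g p : Set HilbertCube))
    (hpeano : ∀ K : Set HilbertCube, IsCompact K → IsConnected K → LocallyConnectedSpace K →
      ∃ X ∈ C, Nonempty (K ≃ₜ X)) : IsCompactifiable C := by
  set G : Set ((ℕ → OnePoint ℕ) × NonemptyCompacts HilbertCube) :=
    closure (range fun p => (baireEmbedding p, g p)) with hG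
  have hGconn : ∀ z ∈ G, IsPreconnected (z.2 : Set HilbertCube) := fun z hz =>
    closure_minimal (by rintro _ ⟨p, rfl⟩; exact hconn p)
      (isClosed_setOf_isPreconnected.preimage continuous_snd) hz
  -- The `n`-th condition is waived once an infinite coordinate occurs before `n`. Without infinite
  -- coordinates all conditions remain and cut out the compactum itself; otherwise the hull at the
  -- first infinite index remains, since hulls decrease. Each condition is closed because it
  -- involves finitely many coordinates.
  set S : Set (G × HilbertCube) := {x | ∀ n, (∃ k < n, x.1.1.1 k = OnePoint.infty) ∨
    x.2 ∈ gridHull n x.1.1.2} with hS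
  have hSc : IsClosed S := by
    have : S = ⋂ n, ((⋃ k ∈ Finset.range n, {x | x.1.1.1 k = OnePoint.infty}) ∪
        {x | x.2 ∈ gridHull n x.1.1.2}) := by
      ext x
      simp [hS]
    rw [this]
    refine isClosed_iInter fun n => IsClosed.union ?_ ?_
    · exact isClosed_biUnion_finset fun k _ => isClosed_singleton.preimage
        (f := fun x : G × HilbertCube => x.1.1.1 k) (by fun_prop)
    · exact (isClosed_setOf_mem_gridHull n).preimage
        (f := fun x : G × HilbertCube => (x.1.1.2, x.2)) (by fun_prop)
  have hgood : ∀ (b : G) p, baireEmbedding p = b.1.1 →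
      {y | (b, y) ∈ S} = (g p : Set HilbertCube) := by
    rintro ⟨⟨x, K⟩, hb⟩ p rfl
    obtain rfl := eq_of_mem_closure_graph isEmbedding_baireEmbedding h.continuous hb
    rw [← iInter_gridHull (g p).isCompact.isClosed]
    ext y
    simp [hS, baireEmbedding]
  have hbad : ∀ b : G, (∃ k, b.1.1 k = OnePoint.infty) →
      ∃ n, {y | (b, y) ∈ S} = gridHull n b.1.2 := by
    classical
    intro b hb
    refine ⟨Nat.find hb, ?_⟩
    ext y
    simp only [hS, mem_ofPred_eq]
    constructor
    · intro hy
      exact (hy (Nat.find hb)).resolve_left fun ⟨k, hk, hk'⟩ => Nat.find_min hb hk hk'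
    · intro hy n
      rcases lt_or_ge (Nat.find hb) n with hn | hn
      · exact Or.inl ⟨_, hn, Nat.find_spec hb⟩
      · exact Or.inr (antitone_gridHull _ hn hy)
  have : CompactSpace G := isCompact_iff_compactSpace.1 isClosed_closure.isCompact
  have : CompactSpace S := isCompact_iff_compactSpace.1 hSc.isCompact
  have : MetrizableSpace (ULift.{u} S) := Homeomorph.ulift.isEmbedding.metrizableSpace
  have : MetrizableSpace (ULift.{u} G) := Homeomorph.ulift.isEmbedding.metrizableSpace
  refine RealizesNonempty.isCompactifiable (q := relationProj.{u} S)
    ⟨continuous_relationProj S, fun b => ?_, fun X hX hne => ?_⟩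
  · by_cases hb : ∃ k, b.down.1.1 k = OnePoint.infty
    · obtain ⟨n, hn⟩ := hbad _ hb
      obtain ⟨X, hX, ⟨φ⟩⟩ := hpeano (gridHull n b.down.1.2) (isCompact_gridHull n _)
        ⟨b.down.1.2.nonempty.mono (subset_gridHull n _),
          isPreconnected_gridHull n (hGconn _ b.down.2)⟩ (locallyConnectedSpace_gridHull n _)
      exact ⟨X, hX, ⟨((relationProjFiber S b).trans (Homeomorph.setCongr hn)).trans φ⟩⟩
    · push Not at hb
      obtain ⟨p, hp⟩ := exists_baireEmbedding_eq hb
      obtain ⟨X, hX, ⟨φ⟩⟩ := h.exists_mem p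
      exact ⟨X, hX, ⟨((relationProjFiber S b).trans (Homeomorph.setCongr (hgood _ p hp))).trans φ⟩⟩
  · obtain ⟨p, ⟨φ⟩⟩ := h.exists_param X hX hne
    let b : G := ⟨(baireEmbedding p, g p), subset_closure ⟨p, rfl⟩⟩
    exact ⟨⟨b⟩, ⟨(φ.trans (Homeomorph.setCongr (hgood b p rfl).symm)).trans
      (relationProjFiber S ⟨b⟩).symm⟩⟩

/-! ### Classes of images, common models and the examples. -/

theorem exists_continuous_surjective_unitInterval (X : Type*) [TopologicalSpace X]
    [MetrizableSpace X] [PreconnectedSpace X] [Nontrivial X] :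
    ∃ f : X → unitInterval, Continuous f ∧ Function.Surjective f := by
  let := metrizableSpaceMetric X
  obtain ⟨a, b, hab⟩ := exists_pair_ne X
  have hd : 0 < dist b a := dist_pos.2 hab.symm
  -- Normalized, clipped distance from `a`; connectedness gives all intermediate values.
  let f : X → unitInterval := fun x => projIcc 0 1 zero_le_one (dist x a / dist b a)
  have hf : Continuous f := continuous_projIcc.comp (by fun_prop)
  have ha : f a = 0 := by simp [f]
  have hb : f b = 1 := by simp [f, div_self hd.ne']
  refine ⟨f, hf, fun t => ?_⟩
  have := isPreconnected_univ.intermediate_value (mem_univ a) (mem_univ b) hf.continuousOn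
  obtain ⟨x, -, hx⟩ := this (show t ∈ Icc (f a) (f b) by rw [ha, hb]; exact ⟨t.2.1, t.2.2⟩)
  exact ⟨x, hx⟩

theorem MapsOnto.trans {X Y Z : TopCat.{u}} (h : MapsOnto X Y) (h' : MapsOnto Y Z) :
    MapsOnto X Z := by
  obtain ⟨f, hf, hs⟩ := h
  obtain ⟨f', hf', hs'⟩ := h'
  exact ⟨f' ∘ f, hf'.comp hf, hs'.comp hs⟩

theorem mapsOnto_refl (X : TopCat.{u}) : MapsOnto X X := ⟨id, continuous_id, Function.surjective_id⟩

theorem MapsOnto.mem_metrizableContinua {X Y : TopCat.{u}} (h : MapsOnto X Y)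
    (hX : X ∈ metrizableContinua) (hY : Y ∈ metrizableCompacta) : Y ∈ metrizableContinua := by
  obtain ⟨f, hf, hs⟩ := h
  have : PreconnectedSpace X := hX.2
  exact ⟨hY, hs.denseRange.preconnectedSpace hf⟩

theorem mapsOnto_peanoContinuum {X Y : TopCat.{u}} (hX : X ∈ metrizableContinua)
    (hX' : Nontrivial X) (hY : Y ∈ peanoContinua) : MapsOnto X Y := by
  obtain ⟨⟨_, hXm⟩, hXc⟩ := hX
  obtain ⟨⟨⟨_, hYm⟩, hYc⟩, hYne, _⟩ := hY
  have : PreconnectedSpace X := hXc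
  have : ConnectedSpace Y := { hYc with toNonempty := hYne }
  obtain ⟨f, hf, hs⟩ := exists_continuous_surjective_unitInterval X
  obtain ⟨f', hf', hs'⟩ := exists_unitInterval_continuous_surjective Y
  exact ⟨f' ∘ f, hf'.comp hf, hs'.comp hs⟩

theorem isCompactifiable_images {C : Set TopCat.{u}} (hC : C ⊆ metrizableCompacta)
    (h : IsStronglyPolishable C) : IsCompactifiable (continuousImages C ∩ metrizableContinua) := by
  by_cases hne : ∃ X ∈ C, Nonempty X
  · obtain ⟨X₀, hX₀, hX₀ne⟩ := hne
    obtain ⟨g, hg⟩ := (h.parametrizes_images hC hX₀ hX₀ne).2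
    -- A nondegenerate member puts all Peano continua in the class. Otherwise every member is empty
    -- or a point, and one point compactifies the nonempty ones.
    by_cases hnt : ∃ X ∈ continuousImages C ∩ metrizableContinua, Nontrivial X
    · obtain ⟨Y, ⟨⟨X, hX, hXY⟩, hYc⟩, hYnt⟩ := hnt
      refine hg.isCompactifiable (fun p => ?_) fun K hK hKc hKl => ?_
      · obtain ⟨Z, hZ, ⟨φ⟩⟩ := hg.exists_mem p
        have : PreconnectedSpace Z := hZ.2.2
        rw [isPreconnected_iff_preconnectedSpace]
        exact φ.symm.surjective.denseRange.preconnectedSpace φ.symm.continuous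
      · have : CompactSpace K := isCompact_iff_compactSpace.1 hK
        have hKc' := isPreconnected_iff_preconnectedSpace.1 hKc.isPreconnected
        have hu : TopCat.of (ULift.{u} K) ∈ metrizableContinua.{u} :=
          ⟨of_ulift_mem_metrizableCompacta, Homeomorph.ulift.symm.surjective.denseRange.preconnectedSpace
            Homeomorph.ulift.symm.continuous⟩
        have hp : TopCat.of (ULift.{u} K) ∈ peanoContinua.{u} :=
          ⟨hu, hKc.nonempty.to_subtype.map ULift.up, Homeomorph.ulift.locallyConnectedSpace⟩
        exact ⟨_, ⟨⟨X, hX, hXY.trans (mapsOnto_peanoContinuum hYc hYnt hp)⟩, hu⟩,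
          ⟨Homeomorph.ulift.symm⟩⟩
    · push Not at hnt
      obtain ⟨X, hX, ⟨φ⟩⟩ := hg.exists_mem 0
      exact (realizesNonempty_punit hnt hX
        ((g 0).nonempty.to_subtype.map φ)).isCompactifiable
  · push Not at hne
    refine (realizesNonempty_pempty ?_).isCompactifiable
    rintro Y ⟨⟨X, hX, f, -, hs⟩, -⟩
    have := hne X hX
    exact ⟨fun y => isEmptyElim (hs y).choose⟩

theorem isStronglyPolishable_images {C : Set TopCat.{u}} (hC : C ⊆ metrizableCompacta)
    (h : IsStronglyPolishable C) :
    IsStronglyPolishable (continuousImages C ∩ metrizableCompacta) := by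
  by_cases hne : ∃ X ∈ C, Nonempty X
  · obtain ⟨X₀, hX₀, hX₀ne⟩ := hne
    obtain ⟨g, hg⟩ := (h.parametrizes_images hC hX₀ hX₀ne).1
    exact hg.isStronglyPolishable
  · push Not at hne
    refine (realizesNonempty_pempty ?_).isStronglyPolishable IsClosedMap.id IsOpenMap.id
      Function.surjective_id
    rintro Y ⟨⟨X, hX, f, -, hs⟩, -⟩
    have := hne X hX
    exact ⟨fun y => isEmptyElim (hs y).choose⟩

/-- The constant map to a point is a strong composition; for empty `M` the point is the one allowed
outside the range. -/
theorem isStronglyPolishable_singleton {M : TopCat.{u}} (hM : M ∈ metrizableCompacta) :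
    IsStronglyPolishable {M} := by
  obtain ⟨_, _⟩ := hM
  have hfib : ∀ b : PUnit.{u + 1}, Nonempty ((fun _ : M => PUnit.unit.{u + 1}) ⁻¹' {b} ≃ₜ M) :=
    fun b => ⟨(Homeomorph.setCongr (by ext; simp)).trans (Homeomorph.Set.univ M)⟩
  let := metrizableSpaceMetric M
  refine ⟨M, TopCat.of PUnit, fun _ => PUnit.unit, inferInstance,
    inferInstanceAs (PolishSpace PUnit), ⟨fun _ _ => isClosed_discrete (α := PUnit) _,
      fun _ _ => isOpen_discrete (α := PUnit) _, fun _ _ _ _ => rfl⟩, continuous_const, ?_, ?_⟩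
  · rintro _ ⟨b, rfl⟩
    exact ⟨M, rfl, hfib b⟩
  · rintro _ rfl
    exact ⟨_, ⟨PUnit.unit, rfl⟩, (hfib _).map Homeomorph.symm⟩

/-- This reduces a class with a common model to the images of one space; `D` is the class of
compacta or of continua. -/
theorem IsCommonModel.eq_images {M : TopCat.{u}} {C D : Set TopCat.{u}} (hM : IsCommonModel M C)
    (hCD : C ⊆ D) (hD : continuousImages C ∩ D ⊆ C) : continuousImages {M} ∩ D = C := by
  refine subset_antisymm ?_ fun X hX => ⟨⟨M, rfl, hM.2 X hX⟩, hCD hX⟩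
  rintro X ⟨⟨_, rfl, hX⟩, hXD⟩
  exact hD ⟨⟨_, hM.1, hX⟩, hXD⟩

theorem IsCommonModel.isStronglyPolishable {M : TopCat.{u}} {C : Set TopCat.{u}}
    (hM : IsCommonModel M C) (hC : C ⊆ metrizableCompacta) (hcl : ClosedUnderContinuousImages C) :
    IsStronglyPolishable C := by
  have := hC hM.1
  rw [← hM.eq_images hC hcl]
  exact isStronglyPolishable_images (singleton_subset_iff.2 this) (isStronglyPolishable_singleton this)

theorem IsCommonModel.isCompactifiable {M : TopCat.{u}} {C : Set TopCat.{u}}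
    (hM : IsCommonModel M C) (hC : C ⊆ metrizableContinua) (hcl : ClosedUnderContinuousImages C) :
    IsCompactifiable C := by
  have := (hC hM.1).1
  rw [← hM.eq_images hC fun X hX => hcl ⟨hX.1, hX.2.1⟩]
  exact isCompactifiable_images (singleton_subset_iff.2 this) (isStronglyPolishable_singleton this)

theorem closedUnderContinuousImages_peanoContinua :
    ClosedUnderContinuousImages peanoContinua.{u} := by
  rintro Y ⟨⟨X, hX, h⟩, hY⟩
  refine ⟨h.mem_metrizableContinua hX.1 hY, ?_⟩
  obtain ⟨f, hf, hs⟩ := h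
  obtain ⟨⟨⟨_, _⟩, _⟩, hne, _⟩ := hX
  have := hY.2
  exact ⟨hne.map f, locallyConnectedSpace_of_surjective hf hs⟩

theorem isCommonModel_unitInterval :
    IsCommonModel (TopCat.of (ULift.{u} unitInterval)) peanoContinua.{u} := by
  have hc : TopCat.of (ULift.{u} unitInterval) ∈ metrizableContinua.{u} :=
    ⟨of_ulift_mem_metrizableCompacta, Homeomorph.ulift.symm.surjective.denseRange.preconnectedSpace
      Homeomorph.ulift.symm.continuous⟩
  exact ⟨⟨hc, ⟨⟨0⟩⟩, Homeomorph.ulift.locallyConnectedSpace⟩, fun X hX =>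
    mapsOnto_peanoContinuum hc (inferInstanceAs (Nontrivial (ULift.{u} unitInterval))) hX⟩

theorem isCommonModel_images {M : TopCat.{u}} (hM : M ∈ metrizableCompacta) :
    IsCommonModel M (continuousImages {M} ∩ metrizableCompacta) := by
  refine ⟨⟨⟨M, rfl, mapsOnto_refl M⟩, hM⟩, ?_⟩
  rintro X ⟨⟨_, rfl, h⟩, -⟩
  exact h

theorem closedUnderContinuousImages_images (C : Set TopCat.{u}) :
    ClosedUnderContinuousImages (continuousImages C ∩ metrizableCompacta) := by
  rintro Z ⟨⟨Y, ⟨⟨X, hX, hXY⟩, -⟩, hYZ⟩, hZ⟩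
  exact ⟨⟨X, hX, hXY.trans hYZ⟩, hZ⟩

end CompactaClasses

open CompactaClasses in
theorem mainTheorem9 :
    -- continuous images of a strongly Polishable class of compacta
    (∀ C : Set TopCat.{u}, C ⊆ metrizableCompacta → IsStronglyPolishable C →
      IsStronglyPolishable (continuousImages C ∩ metrizableCompacta) ∧
      IsCompactifiable (continuousImages C ∩ metrizableContinua)) ∧
    -- classes of compacta with a common model
    (∀ C : Set TopCat.{u}, C ⊆ metrizableCompacta → ClosedUnderContinuousImages C →
      (∃ M, IsCommonModel M C) → IsStronglyPolishable C) ∧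
    -- classes of continua with a common model
    (∀ C : Set TopCat.{u}, C ⊆ metrizableContinua → ClosedUnderContinuousImages C →
      (∃ M, IsCommonModel M C) → IsCompactifiable C) ∧
    -- Peano continua
    (ClosedUnderContinuousImages peanoContinua.{u} ∧
      IsCommonModel (TopCat.of (ULift.{u} unitInterval)) peanoContinua.{u} ∧
      IsCompactifiable peanoContinua.{u}) ∧
    -- weakly chainable continua
    (∀ P : TopCat.{u}, IsPseudoArc P →
      weaklyChainableContinua P ⊆ metrizableContinua ∧
      ClosedUnderContinuousImages (weaklyChainableContinua P) ∧
      IsCommonModel P (weaklyChainableContinua P) ∧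
      IsCompactifiable (weaklyChainableContinua P)) := by

  refine ⟨fun C hC h => ⟨isStronglyPolishable_images hC h, isCompactifiable_images hC h⟩,
    fun C hC hcl ⟨M, hM⟩ => hM.isStronglyPolishable hC hcl,
    fun C hC hcl ⟨M, hM⟩ => hM.isCompactifiable hC hcl,
    ⟨closedUnderContinuousImages_peanoContinua, isCommonModel_unitInterval,
      isCommonModel_unitInterval.isCompactifiable (fun X hX => hX.1)
        closedUnderContinuousImages_peanoContinua⟩, fun P hP => ?_⟩
  have hcont : weaklyChainableContinua P ⊆ metrizableContinua := by
    rintro X ⟨⟨_, rfl, h⟩, hX⟩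
    exact h.mem_metrizableContinua hP.1 hX
  have hcl : ClosedUnderContinuousImages (weaklyChainableContinua P) :=
    closedUnderContinuousImages_images {P}
  have hM : IsCommonModel P (weaklyChainableContinua P) := isCommonModel_images hP.1.1
  exact ⟨hcont, hcl, hM, hM.isCompactifiable hcont hcl⟩
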